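/- Fix a finite similarity type; algebras are nonempty, and an algebra is trivial if it has one element. A class of algebras is a variety if it is closed under homomorphic images, (isomorphic copies of) subalgebras and direct products, and a quasivariety if it is closed under (isomorphic copies of) subalgebras, direct products and ultraproducts; the empty product is allowed, so every quasivariety contains the trivial algebras. A nontrivial algebra is minimal if it has no proper subalgebras. A congruence on an algebra is compact if it is generated by finitely many pairs, and principal if it is generated by one pair. A congruence $\theta$ on $A$ is a factor congruence if there is a congruence $\theta'$ on $A$ that permutes with $\theta$ and satisfies $\theta\cap\theta'=\varepsilon$ (the identity congruence) and $\theta\vee\theta'=\tau$ (the total congruence). Let $\mathcal V$ be a variety such that (a) every nontrivial algebra of $\mathcal V$ has a minimal subalgebra; (b) every compact congruence of every algebra of $\mathcal V$ is principal; (c) every principal congruence of every algebra of $\mathcal V$ is a factor congruence. Let $\mathcal V_{mh}$ be the class of all $A\in\mathcal V$ such that $A$ is trivial or every minimal algebra of $\mathcal V$ is a homomorphic image of $A$. Let $\mathcal Q_{\mathcal V}$ be the quasivariety generated by the free algebra $F_{\mathcal V}(\omega)$ of $\mathcal V$ on countably infinitely many generators, that is, the smallest quasivariety containing it. Theorem.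 Suppose that $\mathcal V_{mh}$ is a quasivariety. Then $\mathcal V_{mh}=\mathcal Q_{\mathcal V}$. If moreover $\mathcal V$ contains, up to isomorphism, exactly one minimal algebra, then $\mathcal Q_{\mathcal V}$ is primitive, that is, every quasivariety $\mathcal Q_0\subseteq\mathcal Q_{\mathcal V}$ is of the form $\mathcal Q_0=\mathcal Q_{\mathcal V}\cap\mathcal W$ for some variety $\mathcal W$. -/

import Mathlib

open scoped FirstOrder

universe u

namespace UnivAlg

/-- A (nonempty) algebra of the similarity type `L`. The types in use have no relation symbols
(`L.IsAlgebraic`), so that a first-order structure is exactly an algebra. -/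
structure Alg (L : FirstOrder.Language.{0, 0}) where
  carrier : Type u
  [str : L.Structure carrier]
  [nonempty : Nonempty carrier]

instance (L : FirstOrder.Language.{0, 0}) : CoeSort (Alg.{u} L) (Type u) := ⟨Alg.carrier⟩

attribute [instance] Alg.str Alg.nonempty

variable {L : FirstOrder.Language.{0, 0}}

/-! ### Congruences -/

/-- `θ` is compatible with all fundamental operations. -/
def IsCongruence (L : FirstOrder.Language.{0, 0}) {A : Type u} [L.Structure A] (θ : Setoid A) : Prop :=
  ∀ (n : ℕ) (f : L.Functions n) (x y : Fin n → A),
    (∀ i, θ (x i) (y i)) → θ (FirstOrder.Language.Structure.funMap f x) (FirstOrder.Language.Structure.funMap f y)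

/-- The least congruence that contains all pairs of `X`. -/
def congruenceGen (L : FirstOrder.Language.{0, 0}) {A : Type u} [L.Structure A] (X : Set (A × A)) :
    Setoid A :=
  sInf {θ : Setoid A | IsCongruence L θ ∧ ∀ p ∈ X, θ p.1 p.2}

theorem isCongruence_congruenceGen {A : Type u} [L.Structure A] (X : Set (A × A)) :
    IsCongruence L (congruenceGen L X) := by
  intro n f x y h θ hθ
  exact hθ.1 n f x y fun i => h i θ hθ

/-- A compact congruence: generated by a finite set of pairs. -/
def IsCompactCongruence (L : FirstOrder.Language.{0, 0}) {A : Type u} [L.Structure A] (θ : Setoid A) :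
    Prop :=
  ∃ X : Set (A × A), X.Finite ∧ θ = congruenceGen L X

/-- A principal congruence: generated by a single pair. -/
def IsPrincipalCongruence (L : FirstOrder.Language.{0, 0}) {A : Type u} [L.Structure A] (θ : Setoid A) :
    Prop :=
  ∃ a b : A, θ = congruenceGen L {(a, b)}

/-- A factor congruence: a congruence `θ` for which there is a congruence `θ'` such that
`θ ∩ θ'` is the identity, the join of `θ` and `θ'` in the lattice of congruences is the total
congruence, and `θ`, `θ'` permute. -/
def IsFactorCongruence (L : FirstOrder.Language.{0, 0}) {A : Type u} [L.Structure A] (θ : Setoid A) :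
    Prop :=
  IsCongruence L θ ∧ ∃ θ' : Setoid A, IsCongruence L θ' ∧
    θ ⊓ θ' = ⊥ ∧
    (∀ ψ : Setoid A, IsCongruence L ψ → θ ≤ ψ → θ' ≤ ψ → ψ = ⊤) ∧
    ∀ a b : A, (∃ c, θ a c ∧ θ' c b) ↔ ∃ c, θ' a c ∧ θ c b

/-! ### Varieties and quasivarieties -/

/-- The direct product of a family of algebras. -/
def Alg.prod {ι : Type u} (A : ι → Alg.{u} L) : Alg.{u} L where
  carrier := ∀ i, A i
  str :=
    { funMap := fun f x i => FirstOrder.Language.Structure.funMap f fun k => x k i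
      RelMap := fun r x => ∀ i, FirstOrder.Language.Structure.RelMap r fun k => x k i }

/-- The ultraproduct of a family of algebras. -/
def Alg.ultraproduct {ι : Type u} (A : ι → Alg.{u} L) (U : Ultrafilter ι) : Alg.{u} L where
  carrier := (U : Filter ι).Product fun i => A i
  nonempty := ⟨Quotient.mk _ fun i => Classical.arbitrary (A i)⟩

/-- Closure under isomorphic copies of subalgebras. -/
def ClosedUnderS (K : Set (Alg.{u} L)) : Prop :=
  ∀ A ∈ K, ∀ B : Alg.{u} L, Nonempty (B ↪[L] A) → B ∈ K

/-- Closure under homomorphic images. -/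
def ClosedUnderH (K : Set (Alg.{u} L)) : Prop :=
  ∀ A ∈ K, ∀ B : Alg.{u} L, (∃ f : A →[L] B, Function.Surjective f) → B ∈ K

/-- Closure under direct products of arbitrary families. The product of the empty family is the
trivial algebra, so such a class contains the trivial algebra. -/
def ClosedUnderP (K : Set (Alg.{u} L)) : Prop :=
  ∀ (ι : Type u) (A : ι → Alg.{u} L), (∀ i, A i ∈ K) → Alg.prod A ∈ K

/-- Closure under ultraproducts. -/
def ClosedUnderPU (K : Set (Alg.{u} L)) : Prop :=
  ∀ (ι : Type u) (A : ι → Alg.{u} L) (U : Ultrafilter ι),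
    (∀ i, A i ∈ K) → Alg.ultraproduct A U ∈ K

structure IsVariety (K : Set (Alg.{u} L)) : Prop where
  closedH : ClosedUnderH K
  closedS : ClosedUnderS K
  closedP : ClosedUnderP K

structure IsQuasivariety (K : Set (Alg.{u} L)) : Prop where
  closedS : ClosedUnderS K
  closedP : ClosedUnderP K
  closedPU : ClosedUnderPU K

/-- The smallest quasivariety that contains the class `K`. -/
def quasivarietyGen (K : Set (Alg.{u} L)) : Set (Alg.{u} L) :=
  {A | ∀ Q : Set (Alg.{u} L), IsQuasivariety Q → K ⊆ Q → A ∈ Q}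

theorem isQuasivariety_quasivarietyGen (K : Set (Alg.{u} L)) :
    IsQuasivariety (quasivarietyGen K) where
  closedS := fun A hA B hB Q hQ hK => hQ.closedS A (hA Q hQ hK) B hB
  closedP := fun ι A hA Q hQ hK => hQ.closedP ι A fun i => hA i Q hQ hK
  closedPU := fun ι A U hA Q hQ hK => hQ.closedPU ι A U fun i => hA i Q hQ hK

/-- A quasivariety `Q` is primitive if every subquasivariety of `Q` is a relative subvariety,
that is, the intersection of `Q` with a variety. -/
def IsPrimitive (Q : Set (Alg.{u} L)) : Prop :=
  IsQuasivariety Q ∧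
    ∀ Q₀ : Set (Alg.{u} L), IsQuasivariety Q₀ → Q₀ ⊆ Q →
      ∃ W : Set (Alg.{u} L), IsVariety W ∧ Q₀ = Q ∩ W

/-! ### Free algebras -/

/-- The algebra of terms. -/
@[reducible] def termStructure (L : FirstOrder.Language.{0, 0}) (X : Type u) : L.Structure (L.Term X) where
  funMap := fun f t => FirstOrder.Language.Term.func f t
  RelMap := fun _ _ => False

/-- Two terms are identified if the identity `s ≈ t` holds in all algebras of `V`. -/
def identitySetoid (V : Set (Alg.{u} L)) (X : Type u) : Setoid (L.Term X) where
  r s t := ∀ A ∈ V, ∀ v : X → A, s.realize v = t.realize v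
  iseqv :=
    { refl := fun _ _ _ _ => rfl
      symm := fun h A hA v => (h A hA v).symm
      trans := fun h k A hA v => (h A hA v).trans (k A hA v) }

/-- The identities of `V` form a congruence on the algebra of terms. -/
@[reducible] def identityPrestructure (V : Set (Alg.{u} L)) (X : Type u) :
    L.Prestructure (identitySetoid V X) where
  toStructure := termStructure L X
  fun_equiv := fun {n} f x y h A hA v => by
    change FirstOrder.Language.Term.realize v (FirstOrder.Language.Term.func f x) =
      FirstOrder.Language.Term.realize v (FirstOrder.Language.Term.func f y)
    simp only [FirstOrder.Language.Term.realize]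
    congr 1
    funext i
    exact h i A hA v
  rel_equiv := fun _ _ _ => rfl

/-- The free algebra of `V` over a countably infinite set of free generators: the algebra of
terms in countably many variables, modulo the identities of `V`. -/
def freeOmega (V : Set (Alg.{u} L)) : Alg.{u} L where
  carrier := Quotient (identitySetoid V (ULift.{u} ℕ))
  str := @FirstOrder.Language.quotientStructure L _ _ (identityPrestructure V (ULift.{u} ℕ))
  nonempty := ⟨Quotient.mk _ (FirstOrder.Language.Term.var ⟨0⟩)⟩

/-- The quasivariety generated by the free algebra of countably infinite rank of `V`. -/
def quasivarietyFree (V : Set (Alg.{u} L)) : Set (Alg.{u} L) :=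
  quasivarietyGen {freeOmega V}

/-! ### Minimal algebras -/

/-- A nontrivial algebra is minimal if it has no proper subalgebras (subalgebras are
nonempty). -/
def IsMinimalAlgebra (L : FirstOrder.Language.{0, 0}) (A : Type u) [L.Structure A] : Prop :=
  Nontrivial A ∧ ∀ S : L.Substructure A, (S : Set A).Nonempty → S = ⊤

/-- Every nontrivial algebra of `V` has a minimal subalgebra. -/
def IsMsFull (V : Set (Alg.{u} L)) : Prop :=
  ∀ A ∈ V, Nontrivial A → ∃ S : L.Substructure A, IsMinimalAlgebra L S

/-- `A` has every minimal algebra of `V` as a homomorphic image. -/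
def IsMhFull (V : Set (Alg.{u} L)) (A : Alg.{u} L) : Prop :=
  ∀ M ∈ V, IsMinimalAlgebra L M → ∃ f : A →[L] M, Function.Surjective f

/-- The class of mh-full algebras of `V`, with the trivial algebras (which are never mh-full if
`V` has minimal algebras, but lie in every quasivariety). -/
def mhClass (V : Set (Alg.{u} L)) : Set (Alg.{u} L) :=
  {A | A ∈ V ∧ (Subsingleton A ∨ IsMhFull V A)}

/-- Up to isomorphism, `V` contains exactly one minimal algebra. -/
def HasUniqueMinimal (V : Set (Alg.{u} L)) : Prop :=
  ∃ M ∈ V, IsMinimalAlgebra L M ∧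
    ∀ N ∈ V, IsMinimalAlgebra L N → Nonempty (N ≃[L] M)

/-- The condition (FC): `V` is ms-full, compact congruences of algebras of `V` are principal, and
principal congruences of algebras of `V` are factor congruences. -/
structure SatisfiesFC (V : Set (Alg.{u} L)) : Prop where
  msFull : IsMsFull V
  compact_principal : ∀ A ∈ V, ∀ θ : Setoid A,
    IsCompactCongruence L θ → IsPrincipalCongruence L θ
  principal_factor : ∀ A ∈ V, ∀ θ : Setoid A,
    IsPrincipalCongruence L θ → IsFactorCongruence L θ

end UnivAlg

namespace UnivAlg

open FirstOrder FirstOrder.Language Structure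

variable {L : FirstOrder.Language.{0, 0}}

/-! ### Homomorphisms between algebras -/

section Homs

variable [L.IsAlgebraic] {A B : Type*} [L.Structure A] [L.Structure B]

/-! The core is `IsQuasivariety.mem_of_surjective`: if `A` in `V` lies in a quasivariety `Q` and
maps by `f` onto some `B` in `mhClass V`, then `B` lies in `Q`. For nontrivial `B`, let `θ` be
generated by a finite part of `ker f`. By (FC) it has a complement `θ'`, so `A ≅ A/θ × A/θ'`. Since
`B` maps onto any minimal subalgebra of `A/θ'`, there is a homomorphism `A → B → A/θ'`; paired with
`A → A/θ` it gives an endomorphism of `A` with kernel `θ`. So each `A/θ` embeds into `A`, and `B`,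
their direct limit, embeds into an ultrapower of `A`. Taking free algebras for `A` gives `mhClass V
⊆ quasivarietyFree V`; the converse holds because free algebras map onto all minimal ones. Taking
`A` in a subquasivariety `Q₀` shows that `Q₀` is cut out by the variety of its homomorphic images.
-/

/-- For algebraic languages, a map that preserves all operations is a homomorphism. -/
def homOfFunMap (f : A → B)
    (h : ∀ (n : ℕ) (F : L.Functions n) (x : Fin n → A),
      f (funMap F x) = funMap F (f ∘ x)) : A →[L] B where
  toFun := f
  map_fun' := fun F x => h _ F x
  map_rel' := fun r => isEmptyElim r

/-- For algebraic languages, an injective homomorphism is an embedding. -/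
def embeddingOfInjective (f : A →[L] B) (h : Function.Injective f) : A ↪[L] B where
  toFun := f
  inj' := h
  map_fun' := fun F x => f.map_fun F x
  map_rel' := fun r => isEmptyElim r

end Homs

/-! ### Quotients -/

section Quotients

variable [L.IsAlgebraic]

/-- A congruence as a prestructure. -/
@[reducible] def congruencePrestructure {A : Type u} [S : L.Structure A] (θ : Setoid A)
    (hθ : IsCongruence L θ) : L.Prestructure θ where
  toStructure := S
  fun_equiv := fun {n} F x y h => hθ n F x y h
  rel_equiv := fun {_} r => isEmptyElim r

/-- The quotient of an algebra by a congruence. -/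
def Alg.quotient (A : Alg.{u} L) (θ : Setoid A) (hθ : IsCongruence L θ) : Alg.{u} L where
  carrier := Quotient θ
  str := @quotientStructure L _ θ (congruencePrestructure θ hθ)
  nonempty := ⟨Quotient.mk θ (Classical.arbitrary A)⟩

/-- The canonical projection onto a quotient. -/
def Alg.quotientMk (A : Alg.{u} L) (θ : Setoid A) (hθ : IsCongruence L θ) :
    A →[L] A.quotient θ hθ :=
  homOfFunMap (fun a => (Quotient.mk θ a : Quotient θ)) fun _ F x =>
    (@funMap_quotient_mk' L _ θ (congruencePrestructure θ hθ) _ F x).symm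

theorem Alg.quotientMk_surjective (A : Alg.{u} L) (θ : Setoid A) (hθ : IsCongruence L θ) :
    Function.Surjective (A.quotientMk θ hθ) :=
  Quotient.mk_surjective

theorem Alg.quotientMk_eq_iff (A : Alg.{u} L) (θ : Setoid A) (hθ : IsCongruence L θ) {a b : A} :
    A.quotientMk θ hθ a = A.quotientMk θ hθ b ↔ θ a b :=
  Quotient.eq

end Quotients

/-! ### Congruences -/

section Congruences

variable {A : Type u} [L.Structure A]

theorem congruenceGen_le {X : Set (A × A)} {θ : Setoid A} (hθ : IsCongruence L θ)
    (h : ∀ p ∈ X, θ p.1 p.2) : congruenceGen L X ≤ θ :=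
  sInf_le ⟨hθ, h⟩

theorem subset_congruenceGen {X : Set (A × A)} {p : A × A} (hp : p ∈ X) :
    congruenceGen L X p.1 p.2 :=
  fun _ hθ => hθ.2 p hp

theorem isCongruence_ker {B : Type*} [L.Structure B] (f : A →[L] B) :
    IsCongruence L (Setoid.ker f) := by
  intro n F x y h
  change f _ = f _
  rw [f.map_fun, f.map_fun]
  exact congrArg _ (funext h)

/-- Two permuting congruences whose join is total compose to the total relation. -/
theorem exists_rel_rel_of_permute {θ θ' : Setoid A} (hθ : IsCongruence L θ)
    (hθ' : IsCongruence L θ')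
    (hsup : ∀ ψ : Setoid A, IsCongruence L ψ → θ ≤ ψ → θ' ≤ ψ → ψ = ⊤)
    (hperm : ∀ a b : A, (∃ c, θ a c ∧ θ' c b) ↔ ∃ c, θ' a c ∧ θ c b) (a b : A) :
    ∃ c, θ a c ∧ θ' c b := by
  -- Permutability makes the composite of `θ` and `θ'` an equivalence; as a congruence above both,
  -- it is total.
  let ψ : Setoid A :=
    { r := fun a b => ∃ c, θ a c ∧ θ' c b
      iseqv :=
        { refl := fun a => ⟨a, θ.refl a, θ'.refl a⟩
          symm := fun {a b} ⟨c, h, h'⟩ => (hperm b a).2 ⟨c, θ'.symm h', θ.symm h⟩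
          trans := fun {a b d} ⟨c, h, h'⟩ ⟨e, k, k'⟩ => by
            obtain ⟨m, hm, hm'⟩ := (hperm c e).2 ⟨b, h', k⟩
            exact ⟨m, θ.trans h hm, θ'.trans hm' k'⟩ } }
  have hψ : ψ = ⊤ := by
    refine hsup ψ ?_ (fun {x y} h => ⟨y, h, θ'.refl y⟩) fun {x y} h => ⟨x, θ.refl x, h⟩
    intro n F x y h
    choose c hc hc' using h
    exact ⟨funMap F c, hθ n F _ _ hc, hθ' n F _ _ hc'⟩
  have : ψ a b := by rw [hψ]; trivial
  exact this

end Congruences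

/-! ### Endomorphisms with prescribed kernel, and ultrapowers -/

section Kernel

variable [L.IsAlgebraic]

/-- If `θ` and `θ'` are complementary factor congruences of `A`, then a homomorphism from `A` to
`A / θ'` whose kernel contains `θ` induces an endomorphism of `A` with kernel `θ`. -/
theorem exists_endomorphism_ker_eq {A : Alg.{u} L} {θ θ' : Setoid A} (hθ : IsCongruence L θ)
    (hθ' : IsCongruence L θ') (hinf : θ ⊓ θ' = ⊥)
    (hsup : ∀ ψ : Setoid A, IsCongruence L ψ → θ ≤ ψ → θ' ≤ ψ → ψ = ⊤)
    (hperm : ∀ a b : A, (∃ c, θ a c ∧ θ' c b) ↔ ∃ c, θ' a c ∧ θ c b)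
    (g : A →[L] A.quotient θ' hθ') (hg : θ ≤ Setoid.ker g) :
    ∃ h : A →[L] A, ∀ x y, h x = h y ↔ θ x y := by
  have huniq : ∀ x y, θ x y → θ' x y → x = y := fun x y h h' => by
    have : (θ ⊓ θ') x y := ⟨h, h'⟩
    rwa [hinf] at this
  -- In `A ≅ A/θ × A/θ'`, this `y` is the element with coordinates `(x/θ, g x)`.
  have hex : ∀ x, ∃ y, θ x y ∧ A.quotientMk θ' hθ' y = g x := fun x => by
    obtain ⟨c, hc⟩ := A.quotientMk_surjective θ' hθ' (g x)
    obtain ⟨y, hy, hy'⟩ := exists_rel_rel_of_permute hθ hθ' hsup hperm x c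
    exact ⟨y, hy, ((A.quotientMk_eq_iff θ' hθ').2 hy').trans hc⟩
  choose h hh hh' using hex
  refine ⟨homOfFunMap h fun n F x => huniq _ _ ?_ ?_, fun x y => ⟨fun e => ?_, fun e => ?_⟩⟩
  · exact θ.trans (θ.symm (hh _)) (hθ n F _ _ fun i => hh (x i))
  · rw [← A.quotientMk_eq_iff θ' hθ', hh', g.map_fun, Hom.map_fun]
    exact congrArg _ (funext fun i => (hh' (x i)).symm)
  · have e' : h x = h y := e
    exact θ.trans (hh x) (e' ▸ θ.symm (hh y))
  · refine huniq _ _ (θ.trans (θ.symm (hh x)) (θ.trans e (hh y))) ?_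
    exact (A.quotientMk_eq_iff θ' hθ').1 ((hh' x).trans ((hg e).trans (hh' y).symm))

/-- The map to `A/θ'` needed for the endomorphism must factor through `f`, so that it kills `S`;
mh-fullness of `B` supplies it via a minimal subalgebra of `A/θ'`. -/
theorem exists_endomorphism_ker_eq_congruenceGen {V : Set (Alg.{u} L)} (hV : IsVariety V)
    (hFC : SatisfiesFC V) {A B : Alg.{u} L} (hA : A ∈ V) (hB : IsMhFull V B) (f : A →[L] B)
    {S : Set (A × A)} (hS : S.Finite) (hSf : ∀ p ∈ S, f p.1 = f p.2) :
    ∃ h : A →[L] A, ∀ x y, h x = h y ↔ congruenceGen L S x y := by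
  obtain ⟨hθ, θ', hθ', hinf, hsup, hperm⟩ := hFC.principal_factor A hA _
    (hFC.compact_principal A hA (congruenceGen L S) ⟨S, hS, rfl⟩)
  have hC : A.quotient θ' hθ' ∈ V :=
    hV.closedH A hA _ ⟨A.quotientMk θ' hθ', A.quotientMk_surjective θ' hθ'⟩
  rcases subsingleton_or_nontrivial (A.quotient θ' hθ') with hs | hn
  -- A trivial `A/θ'` has no minimal subalgebra, but then every map to it is constant.
  · exact exists_endomorphism_ker_eq hθ hθ' hinf hsup hperm (A.quotientMk θ' hθ')
      fun _ _ _ => Subsingleton.elim _ _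
  · obtain ⟨M, hM⟩ := hFC.msFull _ hC hn
    have : Nontrivial M := hM.1
    let N : Alg.{u} L := ⟨M⟩
    obtain ⟨k, -⟩ := hB N (hV.closedS _ hC N ⟨M.subtype⟩) hM
    refine exists_endomorphism_ker_eq hθ hθ' hinf hsup hperm
      ((M.subtype.toHom.comp k).comp f)
      (congruenceGen_le (isCongruence_ker _) fun p hp => ?_)
    change M.subtype (k (f p.1)) = M.subtype (k (f p.2))
    rw [hSf p hp]

theorem IsQuasivariety.mem_of_subsingleton {Q : Set (Alg.{u} L)} (hQ : IsQuasivariety Q)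
    (B : Alg.{u} L) [Subsingleton B] : B ∈ Q := by
  refine hQ.closedS _ (hQ.closedP PEmpty.{u + 1} (fun i => i.elim) fun i => i.elim) B ?_
  refine ⟨embeddingOfInjective (homOfFunMap (fun _ (i : PEmpty) => i.elim) fun n F x => ?_) ?_⟩
  · funext i
    exact i.elim
  · exact Function.injective_of_subsingleton _

/-- If every finite part of the kernel of `f : A → B` is contained in the kernel of an endomorphism
of `A` whose kernel is contained in that of `f`, then the image of `f` embeds into an ultrapower
of `A`. -/
theorem IsQuasivariety.mem_of_finite_kernels {Q : Set (Alg.{u} L)} (hQ : IsQuasivariety Q)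
    {A B : Alg.{u} L} (hA : A ∈ Q) (f : A →[L] B) (hf : Function.Surjective f)
    (H : ∀ S : Set (A × A), S.Finite → (∀ p ∈ S, f p.1 = f p.2) →
      ∃ h : A →[L] A, (∀ p ∈ S, h p.1 = h p.2) ∧ ∀ x y, h x = h y → f x = f y) : B ∈ Q := by
  classical
  let I := Finset {p : A × A // f p.1 = f p.2}
  have H' : ∀ S : I, ∃ h : A →[L] A, (∀ p ∈ S, h p.1.1 = h p.1.2) ∧
      ∀ x y, h x = h y → f x = f y := fun S => by
    obtain ⟨h, h1, h2⟩ := H (Subtype.val '' (S : Set {p : A × A // f p.1 = f p.2}))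
      (S.finite_toSet.image _) (by rintro _ ⟨p, -, rfl⟩; exact p.2)
    exact ⟨h, fun p hp => h1 _ ⟨p, hp, rfl⟩, h2⟩
  choose h h1 h2 using H'
  -- Each pair of `ker f` belongs to all large finite `S`, so `U`-almost every `h S` identifies it.
  let U : Ultrafilter I := Ultrafilter.of Filter.atTop
  have hU : ∀ x y, f x = f y → ∀ᶠ S in (U : Filter I), h S x = h S y := fun x y e =>
    (Ultrafilter.of_le _) <| by
      filter_upwards [Filter.eventually_ge_atTop ({⟨(x, y), e⟩} : I)] with S hS
      exact h1 S ⟨(x, y), e⟩ (hS (Finset.mem_singleton_self _))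
  choose s hs using hf
  -- Modulo `U` the choice of the preimage `s b` is immaterial, which makes `g` a homomorphism.
  let g : B → Alg.ultraproduct (fun _ : I => A) U := fun b =>
    ((fun S => h S (s b) : (S : I) → A) : (U : Filter I).Product fun _ => A)
  refine hQ.closedS _ (hQ.closedPU I (fun _ => A) U fun _ => hA) B
    ⟨embeddingOfInjective (homOfFunMap g fun n F x => ?_) fun b c e => ?_⟩
  · refine Eq.trans ?_ (Ultraproduct.funMap_cast (u := U) (M := fun _ : I => A) F
      fun i S => h S (s (x i))).symm
    refine Quotient.sound ?_
    have : f (s (funMap F x)) = f (funMap F fun i => s (x i)) := by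
      rw [hs, f.map_fun]
      exact congrArg _ (funext fun i => (hs (x i)).symm)
    filter_upwards [hU _ _ this] with S hS
    exact hS.trans ((h S).map_fun F _)
  · have e' : ∀ᶠ S in (U : Filter I), h S (s b) = h S (s c) := Quotient.exact e
    obtain ⟨S, hS⟩ := e'.exists
    simpa [hs] using h2 S _ _ hS

/-- A quasivariety contains all homomorphic images of its members of `V` that lie in `mhClass V`. -/
theorem IsQuasivariety.mem_of_surjective {V Q : Set (Alg.{u} L)} (hQ : IsQuasivariety Q)
    (hV : IsVariety V) (hFC : SatisfiesFC V) {A B : Alg.{u} L} (hAV : A ∈ V) (hA : A ∈ Q)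
    (hB : B ∈ mhClass V) (f : A →[L] B) (hf : Function.Surjective f) : B ∈ Q := by
  rcases hB.2 with hs | hB
  · exact hQ.mem_of_subsingleton B
  · refine hQ.mem_of_finite_kernels hA f hf fun S hS hSf => ?_
    obtain ⟨h, hh⟩ := exists_endomorphism_ker_eq_congruenceGen hV hFC hAV hB f hS hSf
    exact ⟨h, fun p hp => (hh _ _).2 (subset_congruenceGen hp),
      fun x y e => congruenceGen_le (isCongruence_ker f) hSf ((hh x y).1 e)⟩

end Kernel

/-! ### Free algebras -/

section Free

theorem _root_.FirstOrder.Language.Term.realize_congr_varFinset {X : Type*} [DecidableEq X]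
    {A : Type*} [L.Structure A] {v w : X → A} (t : L.Term X) (h : ∀ x ∈ t.varFinset, v x = w x) :
    t.realize v = t.realize w := by
  induction t with
  | var x => exact h x (by simp [Term.varFinset])
  | func F ts ih =>
    rw [Term.realize_func, Term.realize_func]
    refine congrArg _ (funext fun i => ih i fun x hx => h x ?_)
    simp only [Term.varFinset, Finset.mem_biUnion, Finset.mem_univ, true_and]
    exact ⟨i, hx⟩

/-- The free algebra of `V` over `X`. -/
def freeAlg (V : Set (Alg.{u} L)) (X : Type u) [Nonempty X] : Alg.{u} L where
  carrier := Quotient (identitySetoid V X)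
  str := @quotientStructure L _ _ (identityPrestructure V X)
  nonempty := ⟨Quotient.mk _ (Term.var (Classical.arbitrary X))⟩

variable {V : Set (Alg.{u} L)}

variable {X : Type u} [Nonempty X]

/-- The class of a term in the free algebra. -/
def freeAlg.mk (V : Set (Alg.{u} L)) (t : L.Term X) : freeAlg V X :=
  (Quotient.mk _ t : Quotient (identitySetoid V X))

theorem freeAlg.mk_surjective : Function.Surjective (freeAlg.mk (X := X) V) :=
  Quotient.mk_surjective

theorem freeAlg.mk_eq_iff {s t : L.Term X} :
    freeAlg.mk V s = freeAlg.mk V t ↔ ∀ A ∈ V, ∀ v : X → A, s.realize v = t.realize v :=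
  Quotient.eq (r := identitySetoid V X)

theorem freeAlg.funMap_mk {n : ℕ} (F : L.Functions n) (t : Fin n → L.Term X) :
    funMap F (fun i => freeAlg.mk V (t i)) = freeAlg.mk V (Term.func F t) :=
  @funMap_quotient_mk' L _ _ (identityPrestructure V X) _ F t

/-- `A` satisfies the identities of `V` in the variables `X` under the assignment `v`. -/
def RespectsIdentities (V : Set (Alg.{u} L)) {A : Type*} [L.Structure A] (v : X → A) : Prop :=
  ∀ s t : L.Term X, freeAlg.mk V s = freeAlg.mk V t → s.realize v = t.realize v

theorem respectsIdentities_of_mem {A : Alg.{u} L} (hA : A ∈ V) (v : X → A) :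
    RespectsIdentities V v :=
  fun _ _ h => freeAlg.mk_eq_iff.1 h A hA v

theorem freeAlg.realize_mk_var {X Y : Type u} [Nonempty Y] (g : X → Y) (t : L.Term X) :
    t.realize (fun x => freeAlg.mk V (Term.var (g x))) = freeAlg.mk V (t.relabel g) := by
  induction t with
  | var x => rfl
  | func F ts ih =>
    rw [Term.realize_func, Term.relabel, ← freeAlg.funMap_mk]
    exact congrArg _ (funext ih)

variable [L.IsAlgebraic]

/-- The homomorphic extension of an assignment of the free generators. -/
noncomputable def freeAlg.lift {A : Type*} [L.Structure A] (v : X → A)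
    (hv : RespectsIdentities V v) : freeAlg V X →[L] A :=
  homOfFunMap (fun a => (Function.surjInv freeAlg.mk_surjective a).realize v) fun n F x => by
    have hx : x = fun i => freeAlg.mk V (Function.surjInv freeAlg.mk_surjective (x i)) :=
      funext fun i => (Function.surjInv_eq _ _).symm
    have : freeAlg.mk V (Function.surjInv freeAlg.mk_surjective (funMap F x)) =
        freeAlg.mk V (Term.func F fun i => Function.surjInv freeAlg.mk_surjective (x i)) := by
      exact (Function.surjInv_eq _ _).trans ((congrArg _ hx).trans (freeAlg.funMap_mk F _))
    exact hv _ _ this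

theorem freeAlg.lift_mk {A : Type*} [L.Structure A] (v : X → A) (hv : RespectsIdentities V v)
    (t : L.Term X) : freeAlg.lift v hv (freeAlg.mk V t) = t.realize v :=
  hv _ _ (Function.surjInv_eq _ _)

/-- An algebra belongs to every class that is closed under `S` and `P` and that contains, for any
two distinct elements, an algebra with a homomorphism separating them. -/
theorem mem_of_separating {K : Set (Alg.{u} L)} (hS : ClosedUnderS K) (hP : ClosedUnderP K)
    (A : Alg.{u} L) (h : ∀ a b : A, a ≠ b → ∃ B ∈ K, ∃ f : A →[L] B, f a ≠ f b) : A ∈ K := by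
  choose B hB f hf using h
  let ι := {p : A × A // p.1 ≠ p.2}
  refine hS _ (hP ι (fun p => B p.1.1 p.1.2 p.2) fun p => hB _ _ _) A
    ⟨embeddingOfInjective (homOfFunMap (fun a (p : ι) => f p.1.1 p.1.2 p.2 a)
      fun n F x => ?_) fun a b e => ?_⟩
  · funext p
    exact (f p.1.1 p.1.2 p.2).map_fun F x
  · by_contra hab
    have e' : (fun p : ι => f p.1.1 p.1.2 p.2 a) = fun p : ι => f p.1.1 p.1.2 p.2 b := e
    exact hf a b hab (congrFun e' ⟨(a, b), hab⟩)

theorem freeAlg_mem (hV : IsVariety V) : freeAlg V X ∈ V := by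
  refine mem_of_separating hV.closedS hV.closedP _ fun a b hab => ?_
  obtain ⟨s, rfl⟩ := freeAlg.mk_surjective a
  obtain ⟨t, rfl⟩ := freeAlg.mk_surjective b
  rw [Ne, freeAlg.mk_eq_iff] at hab
  push Not at hab
  obtain ⟨A, hA, v, hv⟩ := hab
  refine ⟨A, hA, freeAlg.lift v (respectsIdentities_of_mem hA v), ?_⟩
  rwa [freeAlg.lift_mk, freeAlg.lift_mk]

/-- Free algebras belong to the quasivariety generated by the free algebra of countable rank. -/
theorem freeAlg_mem_quasivarietyFree (hV : IsVariety V) :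
    freeAlg V X ∈ quasivarietyFree V := by
  classical
  have hQ := isQuasivariety_quasivarietyGen {freeOmega V}
  refine mem_of_separating hQ.closedS hQ.closedP _ fun a b hab => ?_
  refine ⟨freeAlg V (ULift.{u} ℕ), fun Q _ h => h rfl, ?_⟩
  obtain ⟨s, rfl⟩ := freeAlg.mk_surjective a
  obtain ⟨t, rfl⟩ := freeAlg.mk_surjective b
  rw [Ne, freeAlg.mk_eq_iff] at hab
  push Not at hab
  obtain ⟨A, hA, v, hv⟩ := hab
  -- `X` may be uncountable, but only the finitely many variables of `s` and `t` must stay distinct.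
  obtain ⟨g, hg⟩ : ∃ g : X → ULift.{u} ℕ, Set.InjOn g (s.varFinset ∪ t.varFinset : Finset X) := by
    obtain ⟨g, hg⟩ := Countable.exists_injective_nat (s.varFinset ∪ t.varFinset : Finset X)
    refine ⟨fun x => ⟨if h : x ∈ s.varFinset ∪ t.varFinset then g ⟨x, h⟩ else 0⟩, ?_⟩
    intro x hx y hy e
    have hx' : x ∈ s.varFinset ∪ t.varFinset := hx
    have hy' : y ∈ s.varFinset ∪ t.varFinset := hy
    simp only [hx', hy', dif_pos, ULift.up.injEq] at e
    exact congrArg Subtype.val (hg e)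
  refine ⟨freeAlg.lift _ (respectsIdentities_of_mem (freeAlg_mem hV)
    fun x => freeAlg.mk V (Term.var (g x))), ?_⟩
  rw [freeAlg.lift_mk, freeAlg.lift_mk, freeAlg.realize_mk_var, freeAlg.realize_mk_var]
  intro e
  -- Undoing the renaming turns `v` into an assignment that refutes the renamed identity.
  have := freeAlg.mk_eq_iff.1 e A hA
    (v ∘ Function.invFunOn g (s.varFinset ∪ t.varFinset : Finset X))
  rw [Term.realize_relabel, Term.realize_relabel] at this
  refine hv ?_
  have hvx : ∀ x ∈ s.varFinset ∪ t.varFinset, v x =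
      ((v ∘ Function.invFunOn g (s.varFinset ∪ t.varFinset : Finset X)) ∘ g) x := fun x hx =>
    congrArg v (hg.leftInvOn_invFunOn hx).symm
  rw [s.realize_congr_varFinset fun x hx => hvx x (Finset.mem_union_left _ hx),
    t.realize_congr_varFinset fun x hx => hvx x (Finset.mem_union_right _ hx), this]

theorem freeOmega_mem_mhClass (hV : IsVariety V) : freeOmega V ∈ mhClass V := by
  refine ⟨freeAlg_mem (X := ULift.{u} ℕ) hV, Or.inr fun M hM hmin => ?_⟩
  let f : freeAlg V (ULift.{u} ℕ) →[L] M :=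
    freeAlg.lift _ (respectsIdentities_of_mem hM fun _ => Classical.arbitrary M)
  refine ⟨f, fun m => ?_⟩
  -- Any homomorphism into a minimal algebra is onto.
  have : f.range = ⊤ := hmin.2 _ ⟨f (freeAlg.mk V (Term.var ⟨0⟩)), Hom.mem_range_self _ _⟩
  exact Hom.mem_range.1 (this ▸ Substructure.mem_top m)

theorem mhClass_eq_quasivarietyFree (hV : IsVariety V) (hFC : SatisfiesFC V)
    (hmh : IsQuasivariety (mhClass V)) : mhClass V = quasivarietyFree V := by
  refine Set.Subset.antisymm (fun A hA => ?_) fun A hA =>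
    hA _ hmh (Set.singleton_subset_iff.2 (freeOmega_mem_mhClass hV))
  refine (isQuasivariety_quasivarietyGen {freeOmega V}).mem_of_surjective hV hFC
    (freeAlg_mem hV) (freeAlg_mem_quasivarietyFree (X := A) hV) hA
    (freeAlg.lift id (respectsIdentities_of_mem hA.1 id)) fun a => ⟨freeAlg.mk V (Term.var a), ?_⟩
  rw [freeAlg.lift_mk]
  rfl

end Free

/-- The homomorphic images of the members of a quasivariety form a variety. -/
theorem IsQuasivariety.isVariety_images [L.IsAlgebraic] {Q : Set (Alg.{u} L)}
    (hQ : IsQuasivariety Q) :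
    IsVariety {B : Alg.{u} L | ∃ A ∈ Q, ∃ f : A →[L] B, Function.Surjective f} where
  closedH := by
    rintro B ⟨A, hA, f, hf⟩ C ⟨g, hg⟩
    exact ⟨A, hA, g.comp f, hg.comp hf⟩
  closedS := by
    rintro B ⟨A, hA, f, hf⟩ C ⟨g⟩
    have hne : Nonempty (g.toHom.range.comap f) := by
      obtain ⟨a, ha⟩ := hf (g (Classical.arbitrary C))
      exact ⟨⟨a, Classical.arbitrary C, ha.symm⟩⟩
    -- The preimage under `f` of the copy of `C` in `B` is a subalgebra of `A` that maps onto `C`.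
    let S : Alg.{u} L := ⟨g.toHom.range.comap f⟩
    have hS : ∀ a : S, ∃ c : C, g c = f a.1 := fun a => a.2
    choose k hk using hS
    refine ⟨S, hQ.closedS A hA S ⟨(g.toHom.range.comap f).subtype⟩,
      homOfFunMap k fun n F x => g.injective ?_, fun c => ?_⟩
    · rw [hk, g.map_fun]
      exact (f.map_fun F _).trans (congrArg _ (funext fun i => (hk (x i)).symm))
    · obtain ⟨a, ha⟩ := hf (g c)
      exact ⟨⟨a, c, ha.symm⟩, g.injective ((hk _).trans ha)⟩
  closedP := by
    intro ι B hB
    choose A hA f hf using hB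
    refine ⟨Alg.prod A, hQ.closedP ι A hA,
      homOfFunMap (fun a i => f i (a i)) fun n F x => funext fun i => (f i).map_fun F _,
      fun b => ?_⟩
    choose a ha using fun i => hf i (b i)
    exact ⟨a, funext ha⟩

end UnivAlg

/-! ### The equality and primitivity -/

theorem mainTheorem3 (L : FirstOrder.Language.{0, 0}) [L.IsAlgebraic] [Finite (Σ n, L.Functions n)]
    (V : Set (UnivAlg.Alg.{u} L)) (hV : UnivAlg.IsVariety V) (hFC : UnivAlg.SatisfiesFC V)
    (hmh : UnivAlg.IsQuasivariety (UnivAlg.mhClass V)) :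
    UnivAlg.mhClass V = UnivAlg.quasivarietyFree V ∧
      (UnivAlg.HasUniqueMinimal V → UnivAlg.IsPrimitive (UnivAlg.quasivarietyFree V)) := by
  have heq := UnivAlg.mhClass_eq_quasivarietyFree hV hFC hmh
  refine ⟨heq, fun _ => ?_⟩
  rw [← heq]
  refine ⟨hmh, fun Q₀ hQ₀ hle => ⟨_, hQ₀.isVariety_images, Set.Subset.antisymm ?_ ?_⟩⟩
  · exact fun A hA => ⟨hle hA, A, hA, FirstOrder.Language.Hom.id L A, Function.surjective_id⟩
  · rintro B ⟨hB, A, hA, f, hf⟩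
    exact hQ₀.mem_of_surjective hV hFC (hle hA).1 hA hB f hf
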